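/- Let $\mu$ be the Möbius function, let $X\ge 1$ and $a>0$, and let $f$ be a real- or complex-valued function that is (Lebesgue) integrable on $(0,\log X)$. Put $$L(X,b)=\int_0^{\log X} f(x)e^{-bx}\,dx .$$ Then for every $x>0$ the integral $$K_a(x)=\int_0^\infty\Bigl(\sum_{n\ge1}\frac{\mu(n)}{n^2}e^{-a^2y/n^2}\Bigr)\frac{\sqrt\pi}{2}\,y^{-1/2}e^{-x^2/(4y)}\,dy=\lim_{T\to\infty}\int_0^T(\cdots)\,dy$$ converges, the function $f\cdot K_a$ is integrable on $(0,\log X)$, the series below converges (as the limit of its partial sums), and $$\frac{\pi}{2}\sum_{n\ge1}\frac{\mu(n)}{n}\,L\Bigl(X,\frac an\Bigr)=a\int_0^{\log X}f(x)\,K_a(x)\,dx .$$ In particular, for $a=1$, $$\frac{\pi}{2}\sum_{n\ge1}\frac{\mu(n)}{n}\,L\Bigl(X,\frac1n\Bigr)=\int_0^{\log X}f(x)\int_0^\infty\sum_{n\ge1}\frac{\mu(n)}{n^2}e^{-y/n^2}\Bigl(\frac{\sqrt\pi}{2}y^{-1/2}e^{-x^2/(4y)}\Bigr)dy\,dx .$$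 -/

import Mathlib

open MeasureTheory Filter Topology

noncomputable section

/-- The Riesz function `∑_{n ≥ 1} μ(n) n⁻² exp(-t / n²)`, an absolutely convergent series for
`t ≥ 0`. The term `n = 0` vanishes because `μ(0) = 0`. -/
def rieszFunction (t : ℝ) : ℝ :=
  ∑' n : ℕ, (ArithmeticFunction.moebius n : ℝ) / (n : ℝ) ^ 2 * Real.exp (-t / (n : ℝ) ^ 2)

/-- The integrand in `y`: the Riesz function at `a² y` times the heat-kernel factor
`(√π / 2) y^(-1/2) exp(-x² / (4 y))`. -/
def rieszHeatIntegrand (a x y : ℝ) : ℝ :=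
  rieszFunction (a ^ 2 * y) *
    (Real.sqrt Real.pi / 2 * y ^ (-(1 / 2) : ℝ) * Real.exp (-x ^ 2 / (4 * y)))

/-- The integral `∫_0^∞ g(y) dy` converges with value `I`: `g` is Lebesgue integrable on every
`(0, T]`, and `∫_0^T g(y) dy` tends to `I` as `T → ∞`. -/
def HasIntegralZeroInfty (g : ℝ → ℝ) (I : ℝ) : Prop :=
  (∀ T : ℝ, 0 < T → IntegrableOn g (Set.Ioc 0 T) volume) ∧
    Tendsto (fun T : ℝ => ∫ y in (0 : ℝ)..T, g y) atTop (𝓝 I)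

/-- The truncated Laplace transform `L(X, a) = ∫_0^{log X} f(x) exp(-a x) dx`. -/
def truncLaplace {𝕜 : Type*} [RCLike 𝕜] (f : ℝ → 𝕜) (X a : ℝ) : 𝕜 :=
  ∫ x in (0 : ℝ)..Real.log X, f x * ((Real.exp (-(a * x)) : ℝ) : 𝕜)

end

/-! The heat kernel integral `∫_0^∞ exp(-c² y) heatFactor x y dy = π / (2c) · exp(-c x)` with `c = a
/ n` suggests integrating the Riesz function term by term, giving `K_a(x) = π / (2a) · ∑ μ(n)/n ·
exp(-a x / n)`. This series is not absolutely convergent, so the interchange over the whole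
half-line needs an argument.

Over `(0, T]` the interchange is absolute, by comparison with `∑ 1/n²`. What is left is `∑ μ(n)/n ·
heatTail a x T n`. For fixed `T` the weights `heatTail` increase with `n` and stay below `π / (2a)`,
so partial summation against the convergent series `∑ μ(n)/n` makes the remainders small uniformly
in `T`; each single weight tends to zero as `T → ∞`, hence so does the sum
(`tendsto_zero_of_monotoneBounded`). The same summation bounds the partial sums of `∑ μ(n)/n ·
exp(-a x / n)` uniformly in `x` and `N`, and dominated convergence allows integration against `f`.

The arithmetic input is the convergence of `∑ μ(n)/n`, of the depth of the prime number theorem. It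
comes from Ingham's Tauberian theorem and the non-vanishing of `ζ` on `Re s ≥ 1`. -/

/-! ### Ingham's Tauberian theorem. -/

/-- There is an integrable function of total integral `1` that is the Fourier transform of a
continuous function with compact support. -/
theorem exists_fourier_kernel :
    ∃ ψ : ℝ → ℂ, Continuous ψ ∧ HasCompactSupport ψ ∧
      Integrable (FourierTransform.fourier ψ) ∧ ∫ t, FourierTransform.fourier ψ t = 1 := by
  let b : ContDiffBump (0 : ℝ) := ⟨1, 2, one_pos, one_lt_two⟩
  have hc : HasCompactSupport (fun x : ℝ => ((b x : ℝ) : ℂ)) :=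
    b.hasCompactSupport.comp_left (g := ((↑) : ℝ → ℂ)) Complex.ofReal_zero
  have hs : ContDiff ℝ (⊤ : ℕ∞) (fun x : ℝ => ((b x : ℝ) : ℂ)) :=
    Complex.ofRealCLM.contDiff.comp b.contDiff
  let f : SchwartzMap ℝ ℂ := hc.toSchwartzMap hs
  have hf : ⇑f = fun x : ℝ => ((b x : ℝ) : ℂ) := rfl
  have hi : Integrable (FourierTransform.fourier (⇑f)) := by
    rw [← SchwartzMap.fourier_coe]; exact SchwartzMap.integrable _
  refine ⟨f, f.continuous, hc, hi, ?_⟩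
  -- Fourier inversion at `0`: the integral of the transform is the value of the bump at its centre.
  have h := f.integrable.fourierInv_fourier_eq hi (v := 0) f.continuous.continuousAt
  rw [Real.fourierInv_eq] at h
  have hb : b 0 = 1 := b.one_of_mem_closedBall (by simp [b])
  simpa [hf, hb] using h

theorem integrable_mul_exp_neg {φ : ℝ → ℂ} (hφm : Measurable φ) {C : ℝ} (hC : ∀ t, ‖φ t‖ ≤ C)
    (h0 : ∀ t < 0, φ t = 0) {σ : ℝ} (hσ : 0 < σ) :
    Integrable (fun t : ℝ => φ t * ((Real.exp (-σ * t) : ℝ) : ℂ)) := by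
  have hC0 : 0 ≤ C := (norm_nonneg _).trans (hC 0)
  have h1 : IntegrableOn (fun t : ℝ => C * Real.exp (-σ * t)) (Set.Ici 0) :=
    Integrable.const_mul (integrableOn_Ici_iff_integrableOn_Ioi (by simp) |>.2
      (exp_neg_integrableOn_Ioi 0 hσ)) C
  refine ((integrable_indicator_iff measurableSet_Ici).2 h1).mono'
    (hφm.mul (by fun_prop)).aestronglyMeasurable (Eventually.of_forall fun t => ?_)
  rcases lt_or_ge t 0 with ht | ht
  · simp [h0 t ht, Set.indicator, ht.not_ge]
  · rw [Set.indicator_of_mem (Set.mem_Ici.2 ht), norm_mul, Complex.norm_real,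
      Real.norm_of_nonneg (Real.exp_pos _).le]
    exact mul_le_mul_of_nonneg_right (hC t) (Real.exp_pos _).le

/-- The damping `exp(-σ t)` makes `φ` integrable, so the Fourier transform can be moved from `ψ` to
the other factor. Reflection and translation by `T` then turn the transform at `u` into the phase
`exp(-2πi T u)` times the Laplace transform at `σ - 2πi u`. -/
theorem integral_fourier_mul_eq_integral_laplace {φ : ℝ → ℂ} {G : ℂ → ℂ} (hφm : Measurable φ) {C : ℝ}
    (hC : ∀ t : ℝ, ‖φ t‖ ≤ C) (h0 : ∀ t < 0, φ t = 0)
    (hG : ∀ s : ℂ, 0 < s.re → ∫ t : ℝ, φ t * Complex.exp (-s * t) = G s)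
    {ψ : ℝ → ℂ} (hψ : Integrable ψ) (T : ℝ) {σ : ℝ} (hσ : 0 < σ) :
    ∫ t, FourierTransform.fourier ψ t * (φ (T - t) * ((Real.exp (-σ * (T - t)) : ℝ) : ℂ)) =
      FourierTransform.fourier (fun u => ψ u * G (σ - 2 * Real.pi * u * Complex.I)) T := by
  have hint := (integrable_mul_exp_neg hφm hC h0 hσ).comp_sub_left T
  have key := VectorFourier.integral_fourierIntegral_smul_eq_flip (μ := volume) (ν := volume)
    (L := innerₗ ℝ) Real.continuous_fourierChar continuous_inner hψ hint
  simp only [smul_eq_mul] at key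
  refine key.trans ?_
  rw [Real.fourier_real_eq_integral_exp_smul]
  refine integral_congr_ae (Eventually.of_forall fun u => ?_)
  simp only
  have h2 : VectorFourier.fourierIntegral Real.fourierChar volume (innerₗ ℝ).flip
      (fun t => φ (T - t) * ((Real.exp (-σ * (T - t)) : ℝ) : ℂ)) u =
      ∫ t, Complex.exp ((-2 * Real.pi * t * u : ℝ) * Complex.I) •
        (φ (T - t) * ((Real.exp (-σ * (T - t)) : ℝ) : ℂ)) := by
    rw [← Real.fourier_real_eq_integral_exp_smul, Real.fourier_eq]
    simp [VectorFourier.fourierIntegral]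
  rw [h2, ← integral_sub_left_eq_self _ volume T, ← hG (σ - 2 * Real.pi * u * Complex.I) (by simpa using hσ),
    smul_eq_mul, mul_left_comm]
  simp only [← integral_const_mul]
  refine integral_congr_ae (Eventually.of_forall fun t => ?_)
  simp only [sub_sub_cancel, smul_eq_mul, Complex.ofReal_exp]
  congr 1
  rw [mul_left_comm, mul_left_comm (Complex.exp _), ← Complex.exp_add, ← Complex.exp_add]
  congr 2
  push_cast
  ring

/-- Let `σ → 0⁺` in the previous identity. On the Fourier side `ψ` has compact support, so only
values of `G` on a compact part of the closed half-plane occur, and these are bounded. The limit is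
the Fourier transform at `T` of a fixed function, and the Riemann–Lebesgue lemma applies. -/
theorem tendsto_integral_fourier_mul_of_laplace {φ : ℝ → ℂ} {G : ℂ → ℂ} (hφm : Measurable φ) {C : ℝ}
    (hC : ∀ t : ℝ, ‖φ t‖ ≤ C) (h0 : ∀ t < 0, φ t = 0)
    (hGc : ContinuousOn G {s : ℂ | 0 ≤ s.re})
    (hG : ∀ s : ℂ, 0 < s.re → ∫ t : ℝ, φ t * Complex.exp (-s * t) = G s)
    {ψ : ℝ → ℂ} (hψc : Continuous ψ) (hψs : HasCompactSupport ψ)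
    (hψ : Integrable (FourierTransform.fourier ψ)) :
    Tendsto (fun T : ℝ => ∫ t, FourierTransform.fourier ψ t * φ (T - t)) atTop (𝓝 0) := by
  have hboundary : ∀ T : ℝ, ∫ t, FourierTransform.fourier ψ t * φ (T - t) =
      FourierTransform.fourier (fun u => ψ u * G (0 - 2 * Real.pi * u * Complex.I)) T := by
    intro T
    have hL : Tendsto (fun σ : ℝ => ∫ t, FourierTransform.fourier ψ t *
        (φ (T - t) * ((Real.exp (-σ * (T - t)) : ℝ) : ℂ))) (𝓝[>] 0)
        (𝓝 (∫ t, FourierTransform.fourier ψ t * φ (T - t))) := by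
      refine tendsto_integral_filter_of_dominated_convergence
        (fun t => ‖FourierTransform.fourier ψ t‖ * C) ?_ ?_ (hψ.norm.mul_const C) ?_
      · refine Eventually.of_forall fun σ => hψ.aestronglyMeasurable.mul ?_
        exact ((hφm.comp (by fun_prop)).mul (by fun_prop)).aestronglyMeasurable
      · filter_upwards [self_mem_nhdsWithin] with σ hσ
        refine Eventually.of_forall fun t => ?_
        rw [norm_mul]
        refine mul_le_mul_of_nonneg_left ?_ (norm_nonneg _)
        rcases lt_or_ge (T - t) 0 with ht | ht
        · rw [h0 _ ht, zero_mul, norm_zero]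
          exact (norm_nonneg _).trans (hC 0)
        · rw [norm_mul, Complex.norm_real, Real.norm_of_nonneg (Real.exp_pos _).le]
          have : Real.exp (-σ * (T - t)) ≤ 1 := Real.exp_le_one_iff.2
            (by nlinarith [mul_nonneg (le_of_lt hσ) ht])
          calc _ ≤ ‖φ (T - t)‖ * 1 := mul_le_mul_of_nonneg_left this (norm_nonneg _)
            _ ≤ C := by simpa using hC _
      · refine Eventually.of_forall fun t => ?_
        have hc : Continuous fun σ : ℝ => FourierTransform.fourier ψ t *
          (φ (T - t) * ((Real.exp (-σ * (T - t)) : ℝ) : ℂ)) := by fun_prop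
        have := hc.tendsto 0
        simp only [neg_zero, zero_mul, Real.exp_zero, Complex.ofReal_one, mul_one] at this
        exact this.mono_left nhdsWithin_le_nhds
    have hR : Tendsto (fun σ : ℝ => FourierTransform.fourier
        (fun u => ψ u * G (σ - 2 * Real.pi * u * Complex.I)) T) (𝓝[>] 0)
        (𝓝 (FourierTransform.fourier
          (fun u => ψ u * G (0 - 2 * Real.pi * u * Complex.I)) T)) := by
      simp only [Real.fourier_real_eq_integral_exp_smul]
      have hK : IsCompact ((fun p : ℝ × ℝ => ((p.1 : ℂ) - 2 * Real.pi * p.2 * Complex.I)) ''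
          (Set.Icc 0 1 ×ˢ tsupport ψ)) :=
        (isCompact_Icc.prod hψs).image (by fun_prop)
      have hsub : ((fun p : ℝ × ℝ => ((p.1 : ℂ) - 2 * Real.pi * p.2 * Complex.I)) ''
          (Set.Icc 0 1 ×ˢ tsupport ψ)) ⊆ {s : ℂ | 0 ≤ s.re} := by
        rintro _ ⟨p, hp, rfl⟩
        simpa using hp.1.1
      obtain ⟨M, hM⟩ := hK.exists_bound_of_continuousOn (hGc.mono hsub)
      have hGu : ∀ σ : ℝ, 0 ≤ σ → Continuous fun u : ℝ => G (σ - 2 * Real.pi * u * Complex.I) :=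
        fun σ hσ => hGc.comp_continuous (by fun_prop) (fun u => by simpa using hσ)
      refine tendsto_integral_filter_of_dominated_convergence (fun u => ‖ψ u‖ * M) ?_ ?_
        ((hψc.integrable_of_hasCompactSupport hψs).norm.mul_const M) ?_
      · filter_upwards [self_mem_nhdsWithin] with σ hσ
        have := hGu σ (le_of_lt hσ)
        have he : Continuous fun v : ℝ => Complex.exp (((-2 * Real.pi * v * T : ℝ) : ℂ) * Complex.I) := by
          fun_prop
        exact (he.smul (hψc.mul this)).aestronglyMeasurable
      · filter_upwards [Ioc_mem_nhdsGT (zero_lt_one' ℝ)] with σ hσ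
        refine Eventually.of_forall fun u => ?_
        rw [norm_smul, Complex.norm_exp_ofReal_mul_I, one_mul, norm_mul]
        by_cases hu : u ∈ tsupport ψ
        · exact mul_le_mul_of_nonneg_left
            (hM _ ⟨(σ, u), ⟨⟨hσ.1.le, hσ.2⟩, hu⟩, rfl⟩) (norm_nonneg _)
        · simp [image_eq_zero_of_notMem_tsupport hu]
      · refine Eventually.of_forall fun u => ?_
        refine Tendsto.const_smul (Tendsto.const_mul _ ?_) _
        have h1 : Tendsto (fun σ : ℝ => ((σ : ℂ) - 2 * Real.pi * u * Complex.I)) (𝓝[>] 0)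
            (𝓝[{s : ℂ | 0 ≤ s.re}] (0 - 2 * Real.pi * u * Complex.I)) := by
          refine tendsto_nhdsWithin_iff.2 ⟨?_, ?_⟩
          · have hc : Continuous fun σ : ℝ => ((σ : ℂ) - 2 * Real.pi * u * Complex.I) := by
              fun_prop
            have := hc.tendsto 0
            rw [Complex.ofReal_zero] at this
            exact this.mono_left nhdsWithin_le_nhds
          · filter_upwards [self_mem_nhdsWithin] with σ hσ
            simpa using le_of_lt hσ
        exact (hGc _ (by simp)).tendsto.comp h1
    refine tendsto_nhds_unique hL (hR.congr' ?_)
    filter_upwards [self_mem_nhdsWithin] with σ hσ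
    exact (integral_fourier_mul_eq_integral_laplace hφm hC h0 hG
      (hψc.integrable_of_hasCompactSupport hψs) T hσ).symm
  simp only [hboundary]
  exact (Real.zero_at_infty_fourier _).mono_left atTop_le_cocompact

/-- Ingham's Tauberian theorem: a bounded slowly oscillating function whose Laplace transform
extends continuously to the closed right half-plane tends to zero. -/
theorem tendsto_zero_of_laplace_continuousOn {φ : ℝ → ℂ} {G : ℂ → ℂ} (hφm : Measurable φ) {C : ℝ}
    (hC : ∀ t : ℝ, ‖φ t‖ ≤ C) (h0 : ∀ t < 0, φ t = 0)
    (hGc : ContinuousOn G {s : ℂ | 0 ≤ s.re})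
    (hG : ∀ s : ℂ, 0 < s.re → ∫ t : ℝ, φ t * Complex.exp (-s * t) = G s)
    (hosc : ∀ ε > 0, ∃ δ > 0, ∃ T₀ : ℝ, ∀ t t', T₀ ≤ t → T₀ ≤ t' → |t - t'| ≤ δ →
      ‖φ t - φ t'‖ ≤ ε) :
    Tendsto φ atTop (𝓝 0) := by
  obtain ⟨ψ, hψc, hψs, hψ, hψ1⟩ := exists_fourier_kernel
  set k := FourierTransform.fourier ψ with hk
  have hC0 : 0 ≤ C := (norm_nonneg _).trans (hC 0)
  have hknn : 0 ≤ ∫ t, ‖k t‖ := integral_nonneg fun t => norm_nonneg _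
  rw [Metric.tendsto_atTop]
  intro ε hε
  set A := (∫ t, ‖k t‖) + 1 with hA
  have hApos : 0 < A := by positivity
  obtain ⟨δ, hδ, T₀, hT₀⟩ := hosc (ε / (4 * A)) (by positivity)
  -- The tail of `k` will be weighted by `2 * C`; `C + 1` keeps the denominator positive when `C =
  -- 0`.
  obtain ⟨R, hR0, hR⟩ : ∃ R : ℝ, 0 < R ∧
      ∫ t, ‖(Set.Icc (-R) R)ᶜ.indicator k t‖ < ε / (8 * (C + 1)) := by
    have h : Tendsto (fun R : ℝ => ∫ t, ‖(Set.Icc (-R) R)ᶜ.indicator k t‖) atTop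
        (𝓝 (∫ _ : ℝ, (0 : ℝ))) := by
      refine tendsto_integral_filter_of_dominated_convergence (fun t => ‖k t‖) ?_ ?_ hψ.norm ?_
      · exact Eventually.of_forall fun R =>
          (hψ.aestronglyMeasurable.indicator measurableSet_Icc.compl).norm
      · refine Eventually.of_forall fun R => Eventually.of_forall fun t => ?_
        rw [norm_norm]
        exact norm_indicator_le_norm_self _ _
      · refine Eventually.of_forall fun t => ?_
        refine tendsto_const_nhds.congr' ?_
        filter_upwards [eventually_ge_atTop |t|] with R hR
        rw [Set.indicator_of_notMem, norm_zero]
        simpa using abs_le.1 hR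
    rw [integral_zero] at h
    have hev := h.eventually (gt_mem_nhds (show 0 < ε / (8 * (C + 1)) by positivity))
    obtain ⟨R, h1, h2⟩ := (hev.and (eventually_gt_atTop 0)).exists
    exact ⟨R, h2, h1⟩
  -- Dilating by `l` makes the window `|t| ≤ R`, which carries most of `k`, correspond to shifts of
  -- `φ` by at most `δ`.
  set l := R / δ with hl
  have hlpos : 0 < l := div_pos hR0 hδ
  have hconv := tendsto_integral_fourier_mul_of_laplace (φ := fun t => φ (t / l))
    (G := fun s => l * G (l * s)) (C := C) (hφm.comp (by fun_prop)) (fun t => hC _)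
    (fun t ht => h0 _ (div_neg_of_neg_of_pos ht hlpos))
    (continuousOn_const.mul (hGc.comp (by fun_prop) (fun s (hs : 0 ≤ s.re) => by
      simpa using mul_nonneg hlpos.le hs)))
    (fun s hs => by
      rw [← hG _ (by simpa using mul_pos hlpos hs)]
      have := Measure.integral_comp_div (fun t : ℝ => φ t * Complex.exp (-(l * s) * t)) l
      rw [abs_of_pos hlpos, Complex.real_smul] at this
      rw [← this]
      refine integral_congr_ae (Eventually.of_forall fun t => ?_)
      have : (l : ℂ) ≠ 0 := by exact_mod_cast hlpos.ne'
      simp only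
      congr 2
      push_cast
      field_simp) hψc hψs hψ
  rw [← hk] at hconv
  rw [Metric.tendsto_atTop] at hconv
  obtain ⟨T₁, hT₁⟩ := hconv (ε / 4) (by positivity)
  refine ⟨max (T₀ + δ) (T₁ / l), fun T hT => ?_⟩
  have hTa : T₀ + δ ≤ T := (le_max_left _ _).trans hT
  have hTb : T₁ ≤ T * l := (div_le_iff₀ hlpos).1 ((le_max_right _ _).trans hT)
  have hsmall := hT₁ _ hTb
  rw [dist_zero_right] at hsmall ⊢
  have hTl : ∀ t, (T * l - t) / l = T - t / l := fun t => by field_simp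
  simp only [hTl] at hsmall
  have hi1 : Integrable fun t => k t * φ (T - t / l) := by
    refine hψ.mul_bdd (c := C) (hφm.comp (by fun_prop)).aestronglyMeasurable
      (Eventually.of_forall fun t => hC _)
  -- Since `k` has integral `1`, `φ T` differs from its average by an average of increments: small
  -- by slow oscillation inside the window, at most `2 * C` outside it.
  have hdiff : φ T - ∫ t, k t * φ (T - t / l) = ∫ t, k t * (φ T - φ (T - t / l)) := by
    simp only [mul_sub]
    rw [integral_sub (hψ.mul_const _) hi1, integral_mul_const, hψ1, one_mul]
  have hbd : ‖∫ t, k t * (φ T - φ (T - t / l))‖ ≤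
      ∫ t, (ε / (4 * A) * ‖k t‖ + 2 * C * ‖(Set.Icc (-R) R)ᶜ.indicator k t‖) := by
    refine norm_integral_le_of_norm_le ((hψ.norm.const_mul _).add
      ((hψ.indicator measurableSet_Icc.compl).norm.const_mul _))
      (Eventually.of_forall fun t => ?_)
    rw [norm_mul]
    by_cases ht : t ∈ Set.Icc (-R) R
    · have hd : |t / l| ≤ δ := by
        rw [abs_div, abs_of_pos hlpos, div_le_iff₀ hlpos, hl, mul_div_cancel₀ _ hδ.ne']
        exact abs_le.2 ht
      have := hT₀ T (T - t / l) (by linarith) (by linarith [(abs_le.1 hd).2]) (by simpa using hd)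
      rw [Set.indicator_of_notMem (by simpa using ht)]
      rw [norm_zero, mul_zero, add_zero, mul_comm]
      exact mul_le_mul_of_nonneg_right this (norm_nonneg _)
    · rw [Set.indicator_of_mem (by simpa using ht)]
      have : ‖φ T - φ (T - t / l)‖ ≤ 2 * C :=
        (norm_sub_le _ _).trans (by linarith [hC T, hC (T - t / l)])
      have h3 : 0 ≤ ε / (4 * A) * ‖k t‖ := by positivity
      nlinarith [mul_le_mul_of_nonneg_left this (norm_nonneg (k t))]
  rw [integral_add (hψ.norm.const_mul _)
    ((hψ.indicator measurableSet_Icc.compl).norm.const_mul _), integral_const_mul,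
    integral_const_mul, ← hdiff] at hbd
  have e1 : ε / (4 * A) * ∫ t, ‖k t‖ ≤ ε / 4 := by
    have : ε / (4 * A) * A = ε / 4 := by field_simp
    rw [← this]
    exact mul_le_mul_of_nonneg_left (by linarith) (by positivity)
  have e2 : 2 * C * ∫ t, ‖(Set.Icc (-R) R)ᶜ.indicator k t‖ ≤ ε / 4 := by
    have h4 : 2 * (C + 1) * (ε / (8 * (C + 1))) = ε / 4 := by field_simp; ring
    have h5 : 0 ≤ ∫ t, ‖(Set.Icc (-R) R)ᶜ.indicator k t‖ := integral_nonneg fun t => norm_nonneg _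
    nlinarith
  have := norm_add_le (φ T - ∫ t, k t * φ (T - t / l)) (∫ t, k t * φ (T - t / l))
  rw [sub_add_cancel] at this
  linarith

/-! ### Convergence of `∑ μ(n)/n`. -/

theorem Finset.Icc_one_eq_Ioc_zero (N : ℕ) : Finset.Icc 1 N = Finset.Ioc 0 N := by
  ext; simp [Nat.succ_le_iff]

theorem sum_moebius_mul_div (N : ℕ) (hN : 1 ≤ N) :
    ∑ n ∈ Finset.Icc 1 N, (ArithmeticFunction.moebius n : ℝ) * ((N / n : ℕ) : ℝ) = 1 := by
  have h := ArithmeticFunction.sum_Ioc_mul_zeta_eq_sum ArithmeticFunction.moebius N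
  rw [ArithmeticFunction.moebius_mul_coe_zeta] at h
  have h1 : ∑ n ∈ Finset.Ioc 0 N, (1 : ArithmeticFunction ℤ) n = 1 := by
    rw [Finset.sum_eq_single 1 (fun b _ hb => ArithmeticFunction.one_apply_ne hb)
      (fun h => absurd (Finset.mem_Ioc.2 ⟨one_pos, hN⟩) h)]
    simp
  rw [h1] at h
  rw [Finset.Icc_one_eq_Ioc_zero]
  have h' := congrArg ((↑) : ℤ → ℝ) h.symm
  simpa only [Int.cast_sum, Int.cast_mul, Int.cast_natCast, Int.cast_one] using h'

theorem abs_moebius_real_le_one (n : ℕ) : |(ArithmeticFunction.moebius n : ℝ)| ≤ 1 := by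
  exact_mod_cast ArithmeticFunction.abs_moebius_le_one (n := n)

/-- Replacing `⌊N/n⌋` by `N/n` in the preceding identity costs at most `1` per term, so `N · |∑
μ(n)/n| ≤ 1 + N ≤ 2N`. -/
theorem abs_sum_moebius_div_le (N : ℕ) :
    |∑ n ∈ Finset.Icc 1 N, (ArithmeticFunction.moebius n : ℝ) / n| ≤ 2 := by
  rcases Nat.eq_zero_or_pos N with rfl | hN
  · simp
  have hNr : (1 : ℝ) ≤ N := by exact_mod_cast hN
  have hN0 : (0 : ℝ) < N := by linarith
  have hfrac : |∑ n ∈ Finset.Icc 1 N, (ArithmeticFunction.moebius n : ℝ) *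
      ((N : ℝ) / n - ((N / n : ℕ) : ℝ))| ≤ N := by
    refine (Finset.abs_sum_le_sum_abs _ _).trans ?_
    calc _ ≤ ∑ n ∈ Finset.Icc 1 N, (1 : ℝ) := by
          refine Finset.sum_le_sum fun n hn => ?_
          have hlo : ((N / n : ℕ) : ℝ) ≤ (N : ℝ) / n := Nat.cast_div_le
          have hn0 : 0 < n := (Finset.mem_Icc.1 hn).1
          have hhi : (N : ℝ) / n < ((N / n : ℕ) : ℝ) + 1 := by
            rw [div_lt_iff₀ (by exact_mod_cast hn0)]
            exact_mod_cast (Nat.lt_mul_of_div_lt (Nat.lt_succ_self (N / n)) hn0)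
          rw [abs_mul, abs_of_nonneg (by linarith : 0 ≤ (N : ℝ) / n - ((N / n : ℕ) : ℝ))]
          exact mul_le_one₀ (abs_moebius_real_le_one n) (by linarith) (by linarith)
      _ = N := by simp
  have hsum : (N : ℝ) * ∑ n ∈ Finset.Icc 1 N, (ArithmeticFunction.moebius n : ℝ) / n =
      1 + ∑ n ∈ Finset.Icc 1 N, (ArithmeticFunction.moebius n : ℝ) *
        ((N : ℝ) / n - ((N / n : ℕ) : ℝ)) := by
    rw [← sum_moebius_mul_div N hN, ← Finset.sum_add_distrib, Finset.mul_sum]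
    exact Finset.sum_congr rfl fun n _ => by ring
  have h3 : (N : ℝ) * |∑ n ∈ Finset.Icc 1 N, (ArithmeticFunction.moebius n : ℝ) / n| ≤ 1 + N := by
    rw [← abs_of_pos hN0, ← abs_mul, abs_of_pos hN0, hsum]
    refine (abs_add_le _ _).trans ?_
    rw [abs_one]
    linarith
  by_contra! hlt
  nlinarith

/-- The partial sums `∑_{n ≤ eᵗ} μ(n) / n`. -/
noncomputable def moebiusDivSum (t : ℝ) : ℂ :=
  ∑ n ∈ Finset.Icc 1 ⌊Real.exp t⌋₊, (ArithmeticFunction.moebius n : ℂ) / n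

theorem moebiusDivSum_eq_ofReal (t : ℝ) : moebiusDivSum t =
    ((∑ n ∈ Finset.Icc 1 ⌊Real.exp t⌋₊, (ArithmeticFunction.moebius n : ℝ) / n : ℝ) : ℂ) := by
  simp [moebiusDivSum]

theorem measurable_moebiusDivSum : Measurable moebiusDivSum :=
  (measurable_from_nat (f := fun N : ℕ =>
    ∑ n ∈ Finset.Icc 1 N, (ArithmeticFunction.moebius n : ℂ) / n)).comp
    (Nat.measurable_floor.comp Real.measurable_exp)

theorem norm_moebiusDivSum_le (t : ℝ) : ‖moebiusDivSum t‖ ≤ 2 := by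
  rw [moebiusDivSum_eq_ofReal, Complex.norm_real]
  exact abs_sum_moebius_div_le _

theorem moebiusDivSum_of_neg (t : ℝ) (ht : t < 0) : moebiusDivSum t = 0 := by
  rw [moebiusDivSum, Nat.floor_eq_zero.2 (by simpa using ht)]
  simp

/-- At most `exp t' - exp t + 1` integers lie in `(exp t, exp t']`, each contributing at most
`exp(-t)`. -/
theorem norm_moebiusDivSum_sub_le {t t' : ℝ} (h : t ≤ t') :
    ‖moebiusDivSum t - moebiusDivSum t'‖ ≤ Real.exp (t' - t) - 1 + Real.exp (-t) := by
  have hfl : ⌊Real.exp t⌋₊ ≤ ⌊Real.exp t'⌋₊ := Nat.floor_mono (Real.exp_le_exp.2 h)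
  set p := ⌊Real.exp t⌋₊ with hp
  set q := ⌊Real.exp t'⌋₊ with hq
  have hpos := Real.exp_pos t
  have hdisj : moebiusDivSum t' - moebiusDivSum t =
      ∑ n ∈ Finset.Ioc p q, (ArithmeticFunction.moebius n : ℂ) / n := by
    rw [moebiusDivSum, moebiusDivSum, Finset.Icc_one_eq_Ioc_zero, Finset.Icc_one_eq_Ioc_zero, ← hp, ← hq,
      ← Finset.sum_Ioc_consecutive _ (Nat.zero_le p) hfl]
    ring
  rw [norm_sub_rev, hdisj]
  have hterm : ∀ n ∈ Finset.Ioc p q,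
      ‖(ArithmeticFunction.moebius n : ℂ) / n‖ ≤ Real.exp (-t) := by
    intro n hn
    have hlt : Real.exp t < n := (Nat.lt_floor_add_one _).trans_le
      (by exact_mod_cast (Finset.mem_Ioc.1 hn).1)
    rw [norm_div, Complex.norm_natCast, Real.exp_neg, inv_eq_one_div]
    have h1 : ‖(ArithmeticFunction.moebius n : ℂ)‖ ≤ 1 := by
      rw [Complex.norm_intCast]; exact abs_moebius_real_le_one n
    exact div_le_div₀ zero_le_one h1 hpos hlt.le
  refine (norm_sum_le_of_le _ hterm).trans ?_
  rw [Finset.sum_const, Nat.card_Ioc, nsmul_eq_mul, Nat.cast_sub hfl]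
  have h1 : (q : ℝ) ≤ Real.exp t' := Nat.floor_le (Real.exp_pos _).le
  have h2 : Real.exp t < p + 1 := Nat.lt_floor_add_one _
  have h3 : Real.exp t' * Real.exp (-t) = Real.exp (t' - t) := by
    rw [← Real.exp_add, sub_eq_add_neg]
  have h4 : Real.exp t * Real.exp (-t) = 1 := by rw [← Real.exp_add]; simp
  nlinarith [Real.exp_pos (-t)]

theorem moebiusDivSum_slowly_oscillating (ε : ℝ) (hε : 0 < ε) :
    ∃ δ > 0, ∃ T₀ : ℝ, ∀ t t', T₀ ≤ t → T₀ ≤ t' → |t - t'| ≤ δ →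
      ‖moebiusDivSum t - moebiusDivSum t'‖ ≤ ε := by
  have key : ∀ t t', -Real.log (ε / 2) ≤ t → t ≤ t' → t' - t ≤ Real.log (1 + ε / 2) →
      ‖moebiusDivSum t - moebiusDivSum t'‖ ≤ ε := by
    intro t t' ht htt hd
    refine (norm_moebiusDivSum_sub_le htt).trans ?_
    have h1 : Real.exp (t' - t) ≤ 1 + ε / 2 :=
      (Real.le_log_iff_exp_le (by positivity)).1 hd
    have h2 : Real.exp (-t) ≤ ε / 2 :=
      (Real.le_log_iff_exp_le (by positivity)).1 (by linarith)
    linarith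
  refine ⟨Real.log (1 + ε / 2), Real.log_pos (by linarith), -Real.log (ε / 2), ?_⟩
  intro t t' ht ht' hd
  have := abs_le.1 hd
  rcases le_total t t' with h | h
  · exact key t t' ht h (by linarith)
  · rw [norm_sub_rev]
    exact key t' t ht' h (by linarith)

theorem LSeries_moebius_div {s : ℂ} (hs : 0 < s.re) :
    LSeriesSummable (fun n : ℕ => (ArithmeticFunction.moebius n : ℂ) / n) s ∧
      LSeries (fun n : ℕ => (ArithmeticFunction.moebius n : ℂ) / n) s =
        (riemannZeta (1 + s))⁻¹ := by
  have hs1 : 1 < (1 + s).re := by simpa using hs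
  have hterm : LSeries.term (fun n : ℕ => (ArithmeticFunction.moebius n : ℂ) / n) s =
      LSeries.term (fun n : ℕ => (ArithmeticFunction.moebius n : ℂ)) (1 + s) := by
    funext n
    rcases Nat.eq_zero_or_pos n with rfl | hn
    · simp
    · have hn0 : (n : ℂ) ≠ 0 := by exact_mod_cast hn.ne'
      rw [LSeries.term_of_ne_zero hn.ne', LSeries.term_of_ne_zero hn.ne', Complex.cpow_add _ _ hn0,
        Complex.cpow_one, div_div]
  constructor
  · rw [LSeriesSummable, hterm]
    exact ArithmeticFunction.LSeriesSummable_moebius_iff.2 hs1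
  · rw [LSeries, hterm]
    refine eq_inv_of_mul_eq_one_right ?_
    rw [← ArithmeticFunction.LSeries_zeta_eq_riemannZeta hs1]
    exact ArithmeticFunction.LSeries_zeta_mul_Lseries_moebius hs1

theorem integral_moebiusDivSum_mul_exp {s : ℂ} (hs : 0 < s.re) :
    ∫ t : ℝ, moebiusDivSum t * Complex.exp (-s * t) = (s * riemannZeta (1 + s))⁻¹ := by
  have h1 : ∫ t : ℝ, moebiusDivSum t * Complex.exp (-s * t) =
      ∫ t in Set.Ioi 0, moebiusDivSum t * Complex.exp (-s * t) := by
    rw [← integral_Ici_eq_integral_Ioi]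
    refine (setIntegral_eq_integral_of_forall_compl_eq_zero fun t ht => ?_).symm
    rw [moebiusDivSum_of_neg t (by simpa using ht), zero_mul]
  have hs0 : s ≠ 0 := by rintro rfl; simp at hs
  -- Partial summation writes the Dirichlet series as `s ∫_1^∞ S(u) u^(-s-1) du`; the substitution
  -- `u = exp t` gives the Laplace transform.
  have h2 := LSeries_eq_mul_integral (fun n : ℕ => (ArithmeticFunction.moebius n : ℂ) / n)
    le_rfl hs (LSeries_moebius_div hs).1 (by
      simp only [Real.rpow_zero]
      refine Asymptotics.IsBigO.of_bound 2 (Eventually.of_forall fun N => ?_)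
      have := abs_sum_moebius_div_le N
      rw [← Real.norm_eq_abs, ← Complex.norm_real] at this
      simpa using this)
  rw [(LSeries_moebius_div hs).2, ← Real.exp_zero, ← integral_comp_exp_Ioi] at h2
  rw [h1, mul_inv, h2, inv_mul_cancel_left₀ hs0]
  refine setIntegral_congr_fun measurableSet_Ioi fun t _ => ?_
  simp only [moebiusDivSum, Complex.real_smul]
  rw [mul_left_comm, Complex.cpow_def_of_ne_zero (by simp), Complex.ofReal_exp,
    ← Complex.ofReal_exp, ← Complex.ofReal_log (Real.exp_pos t).le, Real.log_exp,
    Complex.ofReal_exp, ← Complex.exp_add]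
  congr 2
  ring

theorem tendsto_sum_moebius_div :
    Tendsto (fun N : ℕ => ∑ n ∈ Finset.Icc 1 N, (ArithmeticFunction.moebius n : ℝ) / n)
      atTop (𝓝 0) := by
  have hmain : Tendsto moebiusDivSum atTop (𝓝 0) := by
    refine tendsto_zero_of_laplace_continuousOn
      -- The value `1` at `0` is the continuous extension, since `ζ` has a simple pole of residue
      -- `1` at `1`. Elsewhere on `Re s ≥ 0`, continuity rests on `ζ(1 + s) ≠ 0`.
      (G := Function.update (fun s => (s * riemannZeta (1 + s))⁻¹) 0 1)
      measurable_moebiusDivSum norm_moebiusDivSum_le moebiusDivSum_of_neg ?_ ?_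
      moebiusDivSum_slowly_oscillating
    · intro s hs
      refine ContinuousAt.continuousWithinAt ?_
      rcases eq_or_ne s 0 with rfl | hs0
      · rw [continuousAt_update_same]
        have h := riemannZeta_residue_one
        have hsh : Tendsto (fun s : ℂ => 1 + s) (𝓝[≠] 0) (𝓝[≠] 1) := by
          refine tendsto_nhdsWithin_iff.2 ⟨?_, ?_⟩
          · have hc : Continuous fun s : ℂ => 1 + s := by fun_prop
            have := hc.tendsto 0
            rw [add_zero] at this
            exact this.mono_left nhdsWithin_le_nhds
          · filter_upwards [self_mem_nhdsWithin] with s hs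
            simpa using hs
        have := (h.comp hsh).inv₀ one_ne_zero
        simpa [Function.comp_def] using this
      · rw [continuousAt_update_of_ne hs0]
        have h1 : (1 : ℂ) + s ≠ 1 := by simpa using hs0
        have hz : ContinuousAt (fun s => riemannZeta (1 + s)) s :=
          ContinuousAt.comp (g := riemannZeta) (f := fun s => 1 + s)
            (differentiableAt_riemannZeta h1).continuousAt (by fun_prop)
        refine (continuousAt_id.mul hz).inv₀ (mul_ne_zero hs0 ?_)
        exact riemannZeta_ne_zero_of_one_le_re (by simpa using hs)
    · intro s hs
      rw [Function.update_of_ne (by rintro rfl; simp at hs), integral_moebiusDivSum_mul_exp hs]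
  have h2 := hmain.comp (Real.tendsto_log_atTop.comp tendsto_natCast_atTop_atTop)
  have h3 := (Complex.continuous_re.tendsto 0).comp h2
  rw [Complex.zero_re] at h3
  refine h3.congr' ?_
  filter_upwards [eventually_ge_atTop 1] with N hN
  have hN0 : (0 : ℝ) < N := by exact_mod_cast hN
  simp only [Function.comp_apply, moebiusDivSum_eq_ofReal, Complex.ofReal_re, Real.exp_log hN0,
    Nat.floor_natCast]

/-! ### Partial summation, uniform in the weights. -/

/-- The sequence `g` is monotone with values in `[0, C]` on the positive integers. -/
structure MonotoneBounded (C : ℝ) (g : ℕ → ℝ) : Prop where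
  mono : ∀ n, 1 ≤ n → g n ≤ g (n + 1)
  nonneg : ∀ n, 1 ≤ n → 0 ≤ g n
  le : ∀ n, 1 ≤ n → g n ≤ C

/-- Partial summation: one `C` pays for the boundary term, the other for the total variation of `g`,
which telescopes by monotonicity. -/
theorem MonotoneBounded.abs_sum_Ioc_mul_le {a g : ℕ → ℝ} {C ε : ℝ} (hg : MonotoneBounded C g)
    {p : ℕ} (ha : ∀ n, p ≤ n → |∑ i ∈ Finset.Ioc p n, a i| ≤ ε) {q : ℕ} (hpq : p ≤ q) :
    |∑ i ∈ Finset.Ioc p q, a i * g i| ≤ 2 * C * ε := by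
  have hε : 0 ≤ ε := (abs_nonneg _).trans (ha p le_rfl)
  have hC : 0 ≤ C := (hg.nonneg 1 le_rfl).trans (hg.le 1 le_rfl)
  rcases hpq.eq_or_lt with rfl | hlt
  · simp only [Finset.Ioc_self, Finset.sum_empty, abs_zero]
    positivity
  have key : ∀ q, p + 1 ≤ q → |∑ i ∈ Finset.Ioc p q, a i * g i -
      (∑ i ∈ Finset.Ioc p q, a i) * g q| ≤ ε * (g q - g (p + 1)) := by
    intro q hq
    induction q, hq using Nat.le_induction with
    | base => simp
    | succ q hq ih =>
      rw [Finset.sum_Ioc_succ_top (by omega), Finset.sum_Ioc_succ_top (by omega)]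
      have hm := hg.mono q (by omega)
      have e : ∑ i ∈ Finset.Ioc p q, a i * g i + a (q + 1) * g (q + 1) -
          (∑ i ∈ Finset.Ioc p q, a i + a (q + 1)) * g (q + 1) =
          (∑ i ∈ Finset.Ioc p q, a i * g i - (∑ i ∈ Finset.Ioc p q, a i) * g q) -
            (∑ i ∈ Finset.Ioc p q, a i) * (g (q + 1) - g q) := by ring
      rw [e]
      refine (abs_sub _ _).trans ?_
      rw [abs_mul, abs_of_nonneg (sub_nonneg.2 hm)]
      have := mul_le_mul_of_nonneg_right (ha q (by omega)) (sub_nonneg.2 hm)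
      linarith
  have h1 := key q hlt
  have h2 := abs_sub_abs_le_abs_sub (∑ i ∈ Finset.Ioc p q, a i * g i)
    ((∑ i ∈ Finset.Ioc p q, a i) * g q)
  have hgq := hg.nonneg q (by omega)
  have h3 : |(∑ i ∈ Finset.Ioc p q, a i) * g q| ≤ ε * C := by
    rw [abs_mul, abs_of_nonneg hgq]
    exact mul_le_mul (ha q hlt.le) (hg.le q (by omega)) hgq hε
  have h4 : ε * (g q - g (p + 1)) ≤ ε * C := mul_le_mul_of_nonneg_left
    (by linarith [hg.le q (by omega), hg.nonneg (p + 1) (by omega)]) hε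
  linarith

theorem MonotoneBounded.abs_sum_Icc_mul_le {a g : ℕ → ℝ} {C M : ℝ} (hg : MonotoneBounded C g)
    (ha : ∀ n, |∑ i ∈ Finset.Icc 1 n, a i| ≤ M) (N : ℕ) :
    |∑ i ∈ Finset.Icc 1 N, a i * g i| ≤ 2 * C * M := by
  simp only [Finset.Icc_one_eq_Ioc_zero] at ha ⊢
  exact hg.abs_sum_Ioc_mul_le (fun n _ => ha n) (Nat.zero_le N)

/-- The point is the order of quantifiers: `N₀` depends on `C` and `ε` but not on `g`. -/
theorem exists_forall_monotoneBounded_dist_le {a : ℕ → ℝ} {l : ℝ}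
    (ha : Tendsto (fun N => ∑ i ∈ Finset.Icc 1 N, a i) atTop (𝓝 l)) (C : ℝ) {ε : ℝ} (hε : 0 < ε) :
    ∃ N₀, ∀ g, MonotoneBounded C g → ∀ p q, N₀ ≤ p → p ≤ q →
      |∑ i ∈ Finset.Icc 1 q, a i * g i - ∑ i ∈ Finset.Icc 1 p, a i * g i| ≤ ε := by
  by_cases hC : 0 ≤ C
  swap
  · exact ⟨0, fun g hg => absurd ((hg.nonneg 1 le_rfl).trans (hg.le 1 le_rfl)) hC⟩
  have hsub : ∀ (b : ℕ → ℝ) {p q : ℕ}, p ≤ q →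
      ∑ i ∈ Finset.Icc 1 q, b i - ∑ i ∈ Finset.Icc 1 p, b i = ∑ i ∈ Finset.Ioc p q, b i := by
    intro b p q hpq
    rw [Finset.Icc_one_eq_Ioc_zero, Finset.Icc_one_eq_Ioc_zero,
      ← Finset.sum_Ioc_consecutive _ (Nat.zero_le p) hpq]
    ring
  obtain ⟨N₀, hN₀⟩ := Metric.cauchySeq_iff.1 ha.cauchySeq (ε / (2 * (C + 1))) (by positivity)
  refine ⟨N₀, fun g hg p q hp hpq => ?_⟩
  rw [hsub _ hpq]
  refine (hg.abs_sum_Ioc_mul_le (ε := ε / (2 * (C + 1))) (fun n hn => ?_) hpq).trans ?_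
  · rw [← hsub _ hn, ← Real.dist_eq]
    exact (hN₀ n (hp.trans hn) p hp).le
  · rw [mul_div_assoc', div_le_iff₀ (by positivity)]
    nlinarith

/-- Abel's convergence test. -/
theorem MonotoneBounded.exists_tendsto_sum_mul {a g : ℕ → ℝ} {C l : ℝ} (hg : MonotoneBounded C g)
    (ha : Tendsto (fun N => ∑ i ∈ Finset.Icc 1 N, a i) atTop (𝓝 l)) :
    ∃ k, Tendsto (fun N => ∑ i ∈ Finset.Icc 1 N, a i * g i) atTop (𝓝 k) := by
  refine cauchySeq_tendsto_of_complete (Metric.cauchySeq_iff'.2 fun ε hε => ?_)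
  obtain ⟨N₀, hN₀⟩ := exists_forall_monotoneBounded_dist_le ha C (half_pos hε)
  refine ⟨N₀, fun n hn => ?_⟩
  rw [Real.dist_eq]
  linarith [hN₀ g hg N₀ n le_rfl hn]

/-- A conditionally convergent analogue of Tannery's theorem: cut at an `N₀` valid for all `T`, then
let `T → ∞` in the finite head. -/
theorem tendsto_zero_of_monotoneBounded {a : ℕ → ℝ} {g : ℝ → ℕ → ℝ} {H : ℝ → ℝ} {C l : ℝ}
    (ha : Tendsto (fun N => ∑ i ∈ Finset.Icc 1 N, a i) atTop (𝓝 l))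
    (hg : ∀ T, 0 < T → MonotoneBounded C (g T))
    (h0 : ∀ n, 1 ≤ n → Tendsto (fun T => g T n) atTop (𝓝 0))
    (hH : ∀ T, 0 < T →
      Tendsto (fun N => ∑ i ∈ Finset.Icc 1 N, a i * g T i) atTop (𝓝 (H T))) :
    Tendsto H atTop (𝓝 0) := by
  rw [Metric.tendsto_atTop']
  intro ε hε
  obtain ⟨N₀, hN₀⟩ := exists_forall_monotoneBounded_dist_le ha C (half_pos hε)
  have hfin : Tendsto (fun T => ∑ i ∈ Finset.Icc 1 N₀, a i * g T i) atTop (𝓝 0) := by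
    have := tendsto_finsetSum (Finset.Icc 1 N₀) (fun i hi =>
      (h0 i (Finset.mem_Icc.1 hi).1).const_mul (a i))
    simpa using this
  obtain ⟨T₁, hT₁⟩ := Metric.tendsto_atTop.1 hfin (ε / 2) (half_pos hε)
  refine ⟨max T₁ 0, fun T hT => ?_⟩
  have hTp : 0 < T := (le_max_right _ _).trans_lt hT
  have h1 := hT₁ T ((le_max_left _ _).trans hT.le)
  have h2 : |H T - ∑ i ∈ Finset.Icc 1 N₀, a i * g T i| ≤ ε / 2 :=
    le_of_tendsto ((hH T hTp).sub_const _).abs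
      ((eventually_ge_atTop N₀).mono fun q hq => hN₀ _ (hg T hTp) N₀ q le_rfl hq)
  rw [Real.dist_eq, sub_zero] at h1 ⊢
  have := abs_sub_abs_le_abs_sub (H T) (∑ i ∈ Finset.Icc 1 N₀, a i * g T i)
  linarith

/-! ### The Laplace transform of the heat factor. -/

/-- The heat-kernel factor `(√π / 2) y^(-1/2) exp(-x² / (4 y))`. -/
noncomputable def heatFactor (x y : ℝ) : ℝ :=
  Real.sqrt Real.pi / 2 * y ^ (-(1 / 2) : ℝ) * Real.exp (-x ^ 2 / (4 * y))

theorem heatFactor_nonneg (x : ℝ) {y : ℝ} (hy : 0 < y) : 0 ≤ heatFactor x y := by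
  unfold heatFactor; positivity

theorem measurable_heatFactor (x : ℝ) : Measurable (heatFactor x) := by
  unfold heatFactor; fun_prop

/-- `∫₀ᵘ exp(-t²) dt`. -/
noncomputable def gaussPrimitive (u : ℝ) : ℝ := ∫ t in (0 : ℝ)..u, Real.exp (-t ^ 2)

theorem hasDerivAt_gaussPrimitive (u : ℝ) :
    HasDerivAt gaussPrimitive (Real.exp (-u ^ 2)) u := by
  have hc : Continuous fun t : ℝ => Real.exp (-t ^ 2) := by fun_prop
  exact intervalIntegral.integral_hasDerivAt_right (hc.intervalIntegrable _ _)
    (hc.stronglyMeasurableAtFilter _ _) hc.continuousAt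

theorem tendsto_gaussPrimitive_atTop :
    Tendsto gaussPrimitive atTop (𝓝 (Real.sqrt Real.pi / 2)) := by
  have h := intervalIntegral_tendsto_integral_Ioi (f := fun t : ℝ => Real.exp (-t ^ 2)) 0
    (by simpa using (integrable_exp_neg_mul_sq one_pos).integrableOn) tendsto_id
  have h2 := integral_gaussian_Ioi 1
  simp only [neg_mul, one_mul, div_one] at h2
  rwa [h2] at h

theorem gaussPrimitive_neg (u : ℝ) : gaussPrimitive (-u) = -gaussPrimitive u := by
  have := intervalIntegral.integral_comp_neg (fun t : ℝ => Real.exp (-t ^ 2)) (a := -u) (b := 0)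
  simp only [neg_sq, neg_zero, neg_neg] at this
  rw [gaussPrimitive, gaussPrimitive, ← this, intervalIntegral.integral_symm]

theorem tendsto_gaussPrimitive_atBot :
    Tendsto gaussPrimitive atBot (𝓝 (-(Real.sqrt Real.pi / 2))) := by
  refine ((tendsto_gaussPrimitive_atTop.comp tendsto_neg_atBot_atTop).neg).congr fun u => ?_
  simp [gaussPrimitive_neg]

/-- An antiderivative of `y ↦ exp(-c² y) * heatFactor x y`. -/
noncomputable def heatPrimitive (c x y : ℝ) : ℝ :=
  Real.sqrt Real.pi / (2 * c) *
    (Real.exp (-(c * x)) * gaussPrimitive (c * Real.sqrt y - x / 2 / Real.sqrt y) +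
      Real.exp (c * x) * gaussPrimitive (c * Real.sqrt y + x / 2 / Real.sqrt y))

/-- Completing the square, `(c√y ∓ x/(2√y))² = c² y ∓ c x + x²/(4y)`, so both Gaussians yield the
same exponential, and the derivatives of `± x/(2√y)` cancel. -/
theorem hasDerivAt_heatPrimitive {c : ℝ} (hc : 0 < c) (x : ℝ) {y : ℝ} (hy : 0 < y) :
    HasDerivAt (heatPrimitive c x) (Real.exp (-(c ^ 2 * y)) * heatFactor x y) y := by
  have hs : 0 < Real.sqrt y := Real.sqrt_pos.2 hy
  have hss : Real.sqrt y ^ 2 = y := Real.sq_sqrt hy.le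
  have d0 := Real.hasDerivAt_sqrt hy.ne'
  have d1 := (d0.const_mul c)
  have d2 := (hasDerivAt_const y (x / 2)).div d0 hs.ne'
  have dm := ((hasDerivAt_gaussPrimitive _).comp y (d1.sub d2)).const_mul (Real.exp (-(c * x)))
  have dp := ((hasDerivAt_gaussPrimitive _).comp y (d1.add d2)).const_mul (Real.exp (c * x))
  have d := (dm.add dp).const_mul (Real.sqrt Real.pi / (2 * c))
  refine d.congr_deriv ?_
  have e1 : Real.exp (-(c * x)) * Real.exp (-(c * Real.sqrt y - x / 2 / Real.sqrt y) ^ 2) =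
      Real.exp (-(c ^ 2 * y)) * Real.exp (-x ^ 2 / (4 * y)) := by
    rw [← Real.exp_add, ← Real.exp_add]
    congr 1
    rw [← hss]
    field_simp
    rw [Real.sqrt_sq hs.le]
    ring
  have e2 : Real.exp (c * x) * Real.exp (-(c * Real.sqrt y + x / 2 / Real.sqrt y) ^ 2) =
      Real.exp (-(c ^ 2 * y)) * Real.exp (-x ^ 2 / (4 * y)) := by
    rw [← Real.exp_add, ← Real.exp_add]
    congr 1
    rw [← hss]
    field_simp
    rw [Real.sqrt_sq hs.le]
    ring
  have e3 : y ^ (-(1 / 2) : ℝ) = 1 / Real.sqrt y := by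
    rw [Real.rpow_neg hy.le, ← Real.sqrt_eq_rpow, one_div]
  simp only [Pi.sub_apply, Pi.add_apply, Pi.div_apply]
  rw [← mul_assoc, ← mul_assoc, e1, e2, heatFactor, e3]
  field_simp
  ring

theorem tendsto_heatPrimitive_atTop {c : ℝ} (hc : 0 < c) (x : ℝ) :
    Tendsto (heatPrimitive c x) atTop (𝓝 (Real.sqrt Real.pi / (2 * c) *
      (Real.exp (-(c * x)) * (Real.sqrt Real.pi / 2) +
        Real.exp (c * x) * (Real.sqrt Real.pi / 2)))) := by
  have h1 : Tendsto (fun y => c * Real.sqrt y) atTop atTop :=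
    Real.tendsto_sqrt_atTop.const_mul_atTop hc
  have h2 : Tendsto (fun y => x / 2 / Real.sqrt y) atTop (𝓝 0) :=
    Real.tendsto_sqrt_atTop.const_div_atTop _
  have hm : Tendsto (fun y => c * Real.sqrt y - x / 2 / Real.sqrt y) atTop atTop := by
    simpa only [sub_eq_add_neg] using h1.atTop_add h2.neg
  exact (((tendsto_gaussPrimitive_atTop.comp hm).const_mul _).add
    ((tendsto_gaussPrimitive_atTop.comp (h1.atTop_add h2)).const_mul _)).const_mul _

theorem tendsto_heatPrimitive_zero (c : ℝ) {x : ℝ} (hx : 0 < x) :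
    Tendsto (heatPrimitive c x) (𝓝[>] 0) (𝓝 (Real.sqrt Real.pi / (2 * c) *
      (Real.exp (-(c * x)) * (-(Real.sqrt Real.pi / 2)) +
        Real.exp (c * x) * (Real.sqrt Real.pi / 2)))) := by
  have hsq : Tendsto Real.sqrt (𝓝[>] 0) (𝓝[>] 0) := by
    refine tendsto_nhdsWithin_iff.2 ⟨?_, ?_⟩
    · have := Real.continuous_sqrt.tendsto 0
      rw [Real.sqrt_zero] at this
      exact this.mono_left nhdsWithin_le_nhds
    · filter_upwards [self_mem_nhdsWithin] with y hy
      exact Real.sqrt_pos.2 hy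
  have h1 : Tendsto (fun y => c * Real.sqrt y) (𝓝[>] 0) (𝓝 (c * 0)) :=
    (hsq.mono_right nhdsWithin_le_nhds).const_mul c
  have h2 : Tendsto (fun y => x / 2 / Real.sqrt y) (𝓝[>] 0) atTop := by
    simp only [div_eq_mul_inv (x / 2)]
    exact (tendsto_inv_nhdsGT_zero.comp hsq).const_mul_atTop (half_pos hx)
  have hm : Tendsto (fun y => c * Real.sqrt y - x / 2 / Real.sqrt y) (𝓝[>] 0) atBot := by
    simpa only [sub_eq_add_neg, Function.comp_def] using h1.add_atBot (tendsto_neg_atTop_atBot.comp h2)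
  exact (((tendsto_gaussPrimitive_atBot.comp hm).const_mul _).add
    ((tendsto_gaussPrimitive_atTop.comp (h1.add_atTop h2)).const_mul _)).const_mul _

theorem integral_exp_mul_heatFactor {c x : ℝ} (hc : 0 < c) (hx : 0 < x) :
    IntegrableOn (fun y => Real.exp (-(c ^ 2 * y)) * heatFactor x y) (Set.Ioi 0) ∧
      ∫ y in Set.Ioi 0, Real.exp (-(c ^ 2 * y)) * heatFactor x y =
        Real.pi / (2 * c) * Real.exp (-(c * x)) := by
  set A := Real.sqrt Real.pi / (2 * c) * (Real.exp (-(c * x)) * (-(Real.sqrt Real.pi / 2)) +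
    Real.exp (c * x) * (Real.sqrt Real.pi / 2)) with hA
  -- The primitive is redefined at `0` by its right limit; as the integrand is nonnegative, finite
  -- limits at both ends already give integrability.
  have hcont : ContinuousWithinAt (Function.update (heatPrimitive c x) 0 A) (Set.Ici 0) 0 := by
    rw [continuousWithinAt_update_same, Set.Ici_sdiff_left]
    exact tendsto_heatPrimitive_zero c hx
  have hder : ∀ y ∈ Set.Ioi (0 : ℝ), HasDerivAt (Function.update (heatPrimitive c x) 0 A)
      (Real.exp (-(c ^ 2 * y)) * heatFactor x y) y := by
    intro y hy
    refine (hasDerivAt_heatPrimitive hc x hy).congr_of_eventuallyEq ?_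
    filter_upwards [lt_mem_nhds (Set.mem_Ioi.1 hy)] with z hz
    rw [Function.update_of_ne hz.ne']
  have hpos : ∀ y ∈ Set.Ioi (0 : ℝ), 0 ≤ Real.exp (-(c ^ 2 * y)) * heatFactor x y :=
    fun y hy => mul_nonneg (Real.exp_pos _).le (heatFactor_nonneg x hy)
  have hlim := (tendsto_heatPrimitive_atTop hc x).congr'
    (f₂ := Function.update (heatPrimitive c x) 0 A) (by
      filter_upwards [eventually_gt_atTop 0] with z hz
      rw [Function.update_of_ne hz.ne'])
  refine ⟨integrableOn_Ioi_deriv_of_nonneg hcont hder hpos hlim, ?_⟩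
  rw [integral_Ioi_of_hasDerivAt_of_nonneg hcont hder hpos hlim, Function.update_self, hA]
  have hpi := Real.mul_self_sqrt Real.pi_pos.le
  have e : ∀ s E E' : ℝ, s / (2 * c) * (E * (s / 2) + E' * (s / 2)) -
      s / (2 * c) * (E * (-(s / 2)) + E' * (s / 2)) = s * s / (2 * c) * E := by
    intro s E E'; ring
  rw [e, hpi]

/-! ### Tails of the heat integral as monotone weights. -/

/-- The weighted tail `n⁻¹ ∫_T^∞ exp(-a² y / n²) heatFactor x y dy`. -/
noncomputable def heatTail (a x T : ℝ) (n : ℕ) : ℝ :=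
  (n : ℝ)⁻¹ * ∫ y in Set.Ioi T, Real.exp (-((a / n) ^ 2 * y)) * heatFactor x y

theorem heatTail_zero {a x : ℝ} (ha : 0 < a) (hx : 0 < x) {n : ℕ} (hn : 1 ≤ n) :
    heatTail a x 0 n = Real.pi / (2 * a) * Real.exp (-(a / n * x)) := by
  have hn0 : (0 : ℝ) < n := by exact_mod_cast hn
  rw [heatTail, (integral_exp_mul_heatFactor (div_pos ha hn0) hx).2]
  field_simp

/-- The substitution `y = n² w` removes `n` from the exponential and leaves it only in the lower
limit `T / n²` and in `x / n`. Both decrease with `n`, which is what makes the tail increase. -/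
theorem heatTail_eq_integral_scaled (a x : ℝ) {T : ℝ} (hT : 0 ≤ T) {n : ℕ} (hn : 1 ≤ n) :
    heatTail a x T n =
      ∫ w in Set.Ioi (T / (n : ℝ) ^ 2), Real.exp (-(a ^ 2 * w)) * heatFactor (x / n) w := by
  have hn0 : (0 : ℝ) < n := by exact_mod_cast hn
  have hn2 : (0 : ℝ) < (n : ℝ) ^ 2 := by positivity
  have h := integral_comp_mul_left_Ioi
    (fun y => Real.exp (-((a / n) ^ 2 * y)) * heatFactor x y) (T / (n : ℝ) ^ 2) hn2
  rw [mul_div_cancel₀ _ hn2.ne', smul_eq_mul] at h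
  have h' : heatTail a x T n = (n : ℝ) * (((n : ℝ) ^ 2)⁻¹ *
      ∫ y in Set.Ioi T, Real.exp (-((a / n) ^ 2 * y)) * heatFactor x y) := by
    rw [heatTail]; field_simp
  rw [h', ← h, ← integral_const_mul]
  refine setIntegral_congr_fun measurableSet_Ioi fun w hw => ?_
  have hw0 : 0 < w := (div_nonneg hT hn2.le).trans_lt hw
  have e1 : (a / n) ^ 2 * ((n : ℝ) ^ 2 * w) = a ^ 2 * w := by field_simp
  have e2 : -x ^ 2 / (4 * ((n : ℝ) ^ 2 * w)) = -(x / n) ^ 2 / (4 * w) := by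
    rw [div_pow]
    field_simp
  have e3 : ((n : ℝ) ^ 2 * w) ^ (-(1 / 2) : ℝ) = (n : ℝ)⁻¹ * w ^ (-(1 / 2) : ℝ) := by
    rw [Real.mul_rpow hn2.le hw0.le, Real.rpow_neg hn2.le, ← Real.sqrt_eq_rpow,
      Real.sqrt_sq hn0.le]
  simp only [heatFactor]
  rw [e1, e2, e3]
  field_simp

theorem heatFactor_le_of_sq_le {x x' y : ℝ} (hy : 0 < y) (h : x' ^ 2 ≤ x ^ 2) :
    heatFactor x y ≤ heatFactor x' y := by
  unfold heatFactor
  have : -x ^ 2 / (4 * y) ≤ -x' ^ 2 / (4 * y) :=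
    div_le_div_of_nonneg_right (by linarith) (by positivity)
  gcongr

theorem monotoneBounded_heatTail {a x T : ℝ} (ha : 0 < a) (hx : 0 < x) (hT : 0 ≤ T) :
    MonotoneBounded (Real.pi / (2 * a)) (heatTail a x T) := by
  have hnn : ∀ (c z : ℝ) {t w : ℝ}, 0 ≤ t → w ∈ Set.Ioi t →
      0 ≤ Real.exp (-(c ^ 2 * w)) * heatFactor z w :=
    fun c z t w ht hw => mul_nonneg (Real.exp_pos _).le (heatFactor_nonneg z (ht.trans_lt hw))
  refine ⟨fun n hn => ?_, fun n hn => ?_, fun n hn => ?_⟩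
  · rw [heatTail_eq_integral_scaled a x hT hn, heatTail_eq_integral_scaled a x hT (by omega)]
    have hn0 : (0 : ℝ) < n := by exact_mod_cast hn
    have hcast : (n : ℝ) ≤ (n + 1 : ℕ) := by push_cast; linarith
    have hm0 : (0 : ℝ) < (n + 1 : ℕ) := by positivity
    have hp1 : 0 ≤ T / (n : ℝ) ^ 2 := by positivity
    have hp2 : 0 ≤ T / ((n + 1 : ℕ) : ℝ) ^ 2 := by positivity
    have hi1 := (integral_exp_mul_heatFactor (c := a) ha (div_pos hx hn0)).1
    have hi2 := (integral_exp_mul_heatFactor (c := a) ha (div_pos hx hm0)).1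
    have hsub : T / ((n + 1 : ℕ) : ℝ) ^ 2 ≤ T / (n : ℝ) ^ 2 := by gcongr
    refine (setIntegral_mono_on (hi1.mono_set (Set.Ioi_subset_Ioi hp1))
      (hi2.mono_set (Set.Ioi_subset_Ioi hp1)) measurableSet_Ioi fun w hw => ?_).trans
      (setIntegral_mono_set (hi2.mono_set (Set.Ioi_subset_Ioi hp2)) ?_
        (Set.Ioi_subset_Ioi hsub).eventuallyLE)
    · refine mul_le_mul_of_nonneg_left (heatFactor_le_of_sq_le (hp1.trans_lt hw) ?_)
        (Real.exp_pos _).le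
      gcongr
    · exact (ae_restrict_iff' measurableSet_Ioi).2
        (Eventually.of_forall fun w hw => hnn _ _ hp2 hw)
  · exact mul_nonneg (by positivity)
      (setIntegral_nonneg measurableSet_Ioi fun w hw => hnn _ _ hT hw)
  · have hn0 : (0 : ℝ) < n := by exact_mod_cast hn
    have h1 : heatTail a x T n ≤ heatTail a x 0 n := by
      refine mul_le_mul_of_nonneg_left (setIntegral_mono_set
        (integral_exp_mul_heatFactor (div_pos ha hn0) hx).1 ?_
        (Set.Ioi_subset_Ioi hT).eventuallyLE) (by positivity)
      exact (ae_restrict_iff' measurableSet_Ioi).2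
        (Eventually.of_forall fun w hw => hnn _ _ le_rfl hw)
    refine h1.trans ?_
    rw [heatTail_zero ha hx hn]
    refine mul_le_of_le_one_right (by positivity) (Real.exp_le_one_iff.2 ?_)
    rw [neg_nonpos]
    positivity

theorem heatTail_zero_sub {a x T : ℝ} (ha : 0 < a) (hx : 0 < x) (hT : 0 ≤ T) {n : ℕ}
    (hn : 1 ≤ n) : heatTail a x 0 n - heatTail a x T n =
      (n : ℝ)⁻¹ * ∫ y in (0 : ℝ)..T, Real.exp (-((a / n) ^ 2 * y)) * heatFactor x y := by
  have hn0 : (0 : ℝ) < n := by exact_mod_cast hn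
  have hi := (integral_exp_mul_heatFactor (div_pos ha hn0) hx).1
  rw [heatTail, heatTail, ← mul_sub,
    ← intervalIntegral.integral_Ioi_sub_Ioi hi hT]

theorem tendsto_heatTail {a x : ℝ} (ha : 0 < a) (hx : 0 < x) {n : ℕ} (hn : 1 ≤ n) :
    Tendsto (fun T => heatTail a x T n) atTop (𝓝 0) := by
  have hn0 : (0 : ℝ) < n := by exact_mod_cast hn
  have hi := (integral_exp_mul_heatFactor (div_pos ha hn0) hx).1
  have h := (intervalIntegral_tendsto_integral_Ioi 0 hi tendsto_id).const_mul (n : ℝ)⁻¹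
  have h2 := h.const_sub (heatTail a x 0 n)
  rw [← heatTail, sub_self] at h2
  refine h2.congr' ?_
  filter_upwards [eventually_ge_atTop 0] with T hT
  rw [id, ← heatTail_zero_sub ha hx hT hn, sub_sub_cancel]

/-! ### The Riesz function and termwise integration over `(0, T]`. -/

theorem abs_rieszFunction_term_le (n : ℕ) {t : ℝ} (ht : 0 ≤ t) :
    |(ArithmeticFunction.moebius n : ℝ) / (n : ℝ) ^ 2 * Real.exp (-t / (n : ℝ) ^ 2)| ≤
      1 / (n : ℝ) ^ 2 := by
  have h1 : Real.exp (-t / (n : ℝ) ^ 2) ≤ 1 := Real.exp_le_one_iff.2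
    (div_nonpos_of_nonpos_of_nonneg (by linarith) (by positivity))
  rw [abs_mul, Real.abs_exp, abs_div, abs_of_nonneg (by positivity : (0 : ℝ) ≤ (n : ℝ) ^ 2)]
  exact (mul_le_of_le_one_right (by positivity) h1).trans
    (div_le_div_of_nonneg_right (abs_moebius_real_le_one n) (by positivity))

theorem summable_one_div_natCast_sq : Summable fun n : ℕ => 1 / (n : ℝ) ^ 2 :=
  Real.summable_one_div_nat_pow.2 one_lt_two

theorem continuousOn_rieszFunction : ContinuousOn rieszFunction (Set.Ici 0) := by
  unfold rieszFunction
  refine continuousOn_tsum (fun n => by fun_prop) summable_one_div_natCast_sq fun n t ht => ?_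
  exact abs_rieszFunction_term_le n ht

theorem abs_rieszFunction_le {t : ℝ} (ht : 0 ≤ t) :
    |rieszFunction t| ≤ ∑' n : ℕ, 1 / (n : ℝ) ^ 2 :=
  tsum_of_norm_bounded (f := fun n : ℕ =>
    (ArithmeticFunction.moebius n : ℝ) / (n : ℝ) ^ 2 * Real.exp (-t / (n : ℝ) ^ 2))
    summable_one_div_natCast_sq.hasSum fun n => abs_rieszFunction_term_le n ht

theorem integrableOn_heatFactor (x : ℝ) {T : ℝ} (hT : 0 ≤ T) :
    IntegrableOn (heatFactor x) (Set.Ioc 0 T) := by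
  have h : IntegrableOn (fun y : ℝ => Real.sqrt Real.pi / 2 * y ^ (-(1 / 2) : ℝ))
      (Set.Ioc 0 T) := by
    have := intervalIntegral.intervalIntegrable_rpow' (a := 0) (b := T)
      (show (-1 : ℝ) < -(1 / 2) by norm_num)
    exact ((intervalIntegrable_iff_integrableOn_Ioc_of_le hT).1 this).const_mul _
  refine h.mono' (measurable_heatFactor x).aestronglyMeasurable
    ((ae_restrict_iff' measurableSet_Ioc).2 (Eventually.of_forall fun y hy => ?_))
  have hy0 : 0 < y := hy.1
  rw [Real.norm_of_nonneg (heatFactor_nonneg x hy0), heatFactor]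
  refine mul_le_of_le_one_right (by positivity) (Real.exp_le_one_iff.2 ?_)
  exact div_nonpos_of_nonpos_of_nonneg (by nlinarith [sq_nonneg x]) (by positivity)

theorem integrableOn_rieszHeatIntegrand {a : ℝ} (x : ℝ) {T : ℝ} (hT : 0 ≤ T) :
    IntegrableOn (rieszHeatIntegrand a x) (Set.Ioc 0 T) := by
  have hmaps : ∀ y ∈ Set.Ioc 0 T, a ^ 2 * y ∈ Set.Ici (0 : ℝ) :=
    fun y hy => mul_nonneg (sq_nonneg a) hy.1.le
  refine Integrable.bdd_mul (c := ∑' n : ℕ, 1 / (n : ℝ) ^ 2) (integrableOn_heatFactor x hT)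
    ((continuousOn_rieszFunction.comp (by fun_prop) hmaps).aestronglyMeasurable measurableSet_Ioc)
    ((ae_restrict_iff' measurableSet_Ioc).2 (Eventually.of_forall fun y hy => ?_))
  exact abs_rieszFunction_le (hmaps y hy)

theorem tendsto_sum_heatTail_zero_sub {a x T : ℝ} (ha : 0 < a) (hx : 0 < x) (hT : 0 ≤ T) :
    Tendsto (fun N : ℕ => ∑ n ∈ Finset.Icc 1 N, (ArithmeticFunction.moebius n : ℝ) / n *
      (heatTail a x 0 n - heatTail a x T n)) atTop
      (𝓝 (∫ y in (0 : ℝ)..T, rieszHeatIntegrand a x y)) := by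
  set F : ℕ → ℝ → ℝ := fun n y => (ArithmeticFunction.moebius n : ℝ) / (n : ℝ) ^ 2 *
    Real.exp (-(a ^ 2 * y) / (n : ℝ) ^ 2) * heatFactor x y with hF
  have hbound : ∀ n, ∀ y ∈ Set.Ioc 0 T, ‖F n y‖ ≤ 1 / (n : ℝ) ^ 2 * heatFactor x y := by
    intro n y hy
    rw [hF, norm_mul, Real.norm_of_nonneg (heatFactor_nonneg x hy.1)]
    exact mul_le_mul_of_nonneg_right
      (abs_rieszFunction_term_le n (mul_nonneg (sq_nonneg a) hy.1.le)) (heatFactor_nonneg x hy.1)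
  have hbound' : ∀ n, ∀ᵐ y ∂(volume.restrict (Set.Ioc 0 T)),
      ‖F n y‖ ≤ 1 / (n : ℝ) ^ 2 * heatFactor x y := fun n =>
    (ae_restrict_iff' measurableSet_Ioc).2 (Eventually.of_forall fun y hy => hbound n y hy)
  have hi := integrableOn_heatFactor x hT
  have hFi : ∀ n, Integrable (F n) (volume.restrict (Set.Ioc 0 T)) := fun n =>
    (hi.const_mul (1 / (n : ℝ) ^ 2)).mono' (Measurable.aestronglyMeasurable
      (Measurable.mul (by fun_prop) (measurable_heatFactor x))) (hbound' n)
  have hsum : Summable fun n => ∫ y in Set.Ioc 0 T, ‖F n y‖ := by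
    refine Summable.of_nonneg_of_le (fun n => integral_nonneg fun y => norm_nonneg _)
      (fun n => ?_) (summable_one_div_natCast_sq.mul_right (∫ y in Set.Ioc 0 T, heatFactor x y))
    rw [← integral_const_mul]
    exact integral_mono_ae (hFi n).norm (hi.const_mul _) (hbound' n)
  have h := (hasSum_integral_of_summable_integral_norm hFi hsum).tendsto_sum_nat
  have hlim : ∫ y in Set.Ioc 0 T, ∑' n, F n y = ∫ y in (0 : ℝ)..T, rieszHeatIntegrand a x y := by
    rw [intervalIntegral.integral_of_le hT]
    simp only [hF, tsum_mul_right]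
    rfl
  rw [hlim] at h
  -- `range (N + 1)` is `{0}` together with `Icc 1 N`, and the term `n = 0` vanishes.
  refine (h.comp (tendsto_add_atTop_nat 1)).congr fun N => ?_
  rw [Function.comp_apply, Finset.sum_range_eq_add_Ico _ (by omega)]
  have h00 : ∫ y in Set.Ioc 0 T, F 0 y = 0 := by simp [hF]
  rw [h00, zero_add]
  refine Finset.sum_congr (by ext; simp) fun n hn => ?_
  have hn1 : 1 ≤ n := (Finset.mem_Icc.1 hn).1
  have hn0 : (0 : ℝ) < n := by exact_mod_cast hn1
  rw [heatTail_zero_sub ha hx hT hn1, intervalIntegral.integral_of_le hT, ← mul_assoc,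
    ← integral_const_mul]
  congr 1
  funext y
  have e : (a / n) ^ 2 * y = a ^ 2 * y / (n : ℝ) ^ 2 := by rw [div_pow]; ring
  simp only [hF]
  rw [e, neg_div]
  field_simp

/-! ### Evaluation of `K_a` and integration against `f`. -/

theorem monotoneBounded_exp {a x : ℝ} (ha : 0 ≤ a) (hx : 0 ≤ x) :
    MonotoneBounded 1 fun n : ℕ => Real.exp (-(a / n * x)) := by
  refine ⟨fun n hn => ?_, fun n _ => (Real.exp_pos _).le, fun n _ => ?_⟩
  · have hn0 : (0 : ℝ) < n := by exact_mod_cast hn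
    have h : a / ((n + 1 : ℕ) : ℝ) ≤ a / n := by
      push_cast; gcongr; linarith
    exact Real.exp_le_exp.2 (neg_le_neg (mul_le_mul_of_nonneg_right h hx))
  · rw [Real.exp_le_one_iff, neg_nonpos]
    positivity

/-- The candidate value minus the integral up to `T` is exactly `∑ μ(n)/n · heatTail a x T n`, which
tends to zero with the tails. -/
theorem hasIntegralZeroInfty_rieszHeatIntegrand {a x k : ℝ} (ha : 0 < a) (hx : 0 < x)
    (hk : Tendsto (fun N : ℕ => ∑ n ∈ Finset.Icc 1 N, (ArithmeticFunction.moebius n : ℝ) / n *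
      Real.exp (-(a / n * x))) atTop (𝓝 k)) :
    HasIntegralZeroInfty (fun y => rieszHeatIntegrand a x y) (Real.pi / (2 * a) * k) := by
  refine ⟨fun T hT => integrableOn_rieszHeatIntegrand x hT.le, ?_⟩
  have h0 : Tendsto (fun N : ℕ => ∑ n ∈ Finset.Icc 1 N, (ArithmeticFunction.moebius n : ℝ) / n *
      heatTail a x 0 n) atTop (𝓝 (Real.pi / (2 * a) * k)) := by
    refine (hk.const_mul _).congr fun N => ?_
    rw [Finset.mul_sum]
    refine Finset.sum_congr rfl fun n hn => ?_
    rw [heatTail_zero ha hx (Finset.mem_Icc.1 hn).1]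
    ring
  have hH : Tendsto (fun T => Real.pi / (2 * a) * k - ∫ y in (0 : ℝ)..T, rieszHeatIntegrand a x y)
      atTop (𝓝 0) := by
    refine tendsto_zero_of_monotoneBounded tendsto_sum_moebius_div
      (fun T hT => monotoneBounded_heatTail ha hx hT.le) (fun n hn => tendsto_heatTail ha hx hn)
      fun T hT => ?_
    refine (h0.sub (tendsto_sum_heatTail_zero_sub ha hx hT.le)).congr fun N => ?_
    rw [← Finset.sum_sub_distrib]
    exact Finset.sum_congr rfl fun n _ => by ring
  simpa using hH.const_sub (Real.pi / (2 * a) * k)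

theorem corollary2p1p1 {𝕜 : Type*} [RCLike 𝕜] (f : ℝ → 𝕜) (X a : ℝ) (hX : 1 ≤ X) (ha : 0 < a)
    (hf : IntervalIntegrable f volume 0 (Real.log X)) :
    ∃ K : ℝ → ℝ,
      (∀ x : ℝ, 0 < x → HasIntegralZeroInfty (fun y : ℝ => rieszHeatIntegrand a x y) (K x)) ∧
      IntervalIntegrable (fun x : ℝ => f x * ((a * K x : ℝ) : 𝕜)) volume 0 (Real.log X) ∧
      Tendsto
        (fun N : ℕ => ((Real.pi / 2 : ℝ) : 𝕜) * ∑ n ∈ Finset.Icc 1 N,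
          (((ArithmeticFunction.moebius n : ℝ) / (n : ℝ) : ℝ) : 𝕜) *
            truncLaplace f X (a / (n : ℝ)))
        atTop
        (𝓝 (∫ x in (0 : ℝ)..Real.log X, f x * ((a * K x : ℝ) : 𝕜))) := by
  have hlog : 0 ≤ Real.log X := Real.log_nonneg hX
  -- The value chosen for `x ≤ 0` is irrelevant, since only `x ∈ (0, log X]` enters the integrals.
  have hex : ∀ x : ℝ, ∃ k, 0 < x → Tendsto (fun N : ℕ => ∑ n ∈ Finset.Icc 1 N,
      (ArithmeticFunction.moebius n : ℝ) / n * Real.exp (-(a / n * x))) atTop (𝓝 k) := by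
    intro x
    rcases lt_or_ge 0 x with hx | hx
    · obtain ⟨k, hk⟩ := (monotoneBounded_exp ha.le hx.le).exists_tendsto_sum_mul
        tendsto_sum_moebius_div
      exact ⟨k, fun _ => hk⟩
    · exact ⟨0, fun h => absurd h hx.not_gt⟩
  choose k hk using hex
  have hscale : ∀ x, a * (Real.pi / (2 * a) * k x) = Real.pi / 2 * k x := fun x => by field_simp
  refine ⟨fun x => Real.pi / (2 * a) * k x,
    fun x hx => hasIntegralZeroInfty_rieszHeatIntegrand ha hx (hk x hx), ?_⟩
  simp only [hscale]
  set p : ℕ → ℝ → ℝ := fun N x => Real.pi / 2 * ∑ n ∈ Finset.Icc 1 N,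
    (ArithmeticFunction.moebius n : ℝ) / n * Real.exp (-(a / n * x)) with hp
  have hfi : IntegrableOn f (Set.Ioc 0 (Real.log X)) :=
    (intervalIntegrable_iff_integrableOn_Ioc_of_le hlog).1 hf
  have hpc : ∀ N, Continuous fun x => ((p N x : ℝ) : 𝕜) := fun N =>
    RCLike.continuous_ofReal.comp (by fun_prop)
  have hpm : ∀ N, AEStronglyMeasurable (fun x => f x * ((p N x : ℝ) : 𝕜))
      (volume.restrict (Set.Ioc 0 (Real.log X))) := fun N =>
    hfi.aestronglyMeasurable.mul (hpc N).aestronglyMeasurable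
  -- `2 * 1 * 2` is the partial summation bound `2 * C * M` with `C = 1` bounding the exponentials
  -- and `M = 2` bounding the sums of `μ(n)/n`.
  have hbound : ∀ N, ∀ x ∈ Set.Ioc 0 (Real.log X),
      ‖f x * ((p N x : ℝ) : 𝕜)‖ ≤ ‖f x‖ * (Real.pi / 2 * (2 * 1 * 2)) := by
    intro N x hx
    rw [norm_mul, RCLike.norm_ofReal, hp, abs_mul, abs_of_pos Real.pi_div_two_pos]
    have := (monotoneBounded_exp ha.le hx.1.le).abs_sum_Icc_mul_le abs_sum_moebius_div_le N
    gcongr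
  have hbound' : ∀ N, ∀ᵐ x ∂(volume.restrict (Set.Ioc 0 (Real.log X))),
      ‖f x * ((p N x : ℝ) : 𝕜)‖ ≤ ‖f x‖ * (Real.pi / 2 * (2 * 1 * 2)) := fun N =>
    (ae_restrict_iff' measurableSet_Ioc).2 (Eventually.of_forall (hbound N))
  have hlim : ∀ x ∈ Set.Ioc 0 (Real.log X), Tendsto (fun N => f x * ((p N x : ℝ) : 𝕜)) atTop
      (𝓝 (f x * ((Real.pi / 2 * k x : ℝ) : 𝕜))) := fun x hx =>
    (((RCLike.continuous_ofReal (K := 𝕜)).tendsto _).comp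
      ((hk x hx.1).const_mul (Real.pi / 2))).const_mul (f x)
  have hlim' : ∀ᵐ x ∂(volume.restrict (Set.Ioc 0 (Real.log X))),
      Tendsto (fun N => f x * ((p N x : ℝ) : 𝕜)) atTop
        (𝓝 (f x * ((Real.pi / 2 * k x : ℝ) : 𝕜))) :=
    (ae_restrict_iff' measurableSet_Ioc).2 (Eventually.of_forall hlim)
  have hdom := hfi.norm.mul_const (Real.pi / 2 * (2 * 1 * 2))
  constructor
  · rw [intervalIntegrable_iff_integrableOn_Ioc_of_le hlog]
    refine hdom.mono' (aestronglyMeasurable_of_tendsto_ae atTop hpm hlim') ?_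
    filter_upwards [hlim', ae_all_iff.2 hbound'] with x hx hb
    exact le_of_tendsto hx.norm (Eventually.of_forall hb)
  · rw [intervalIntegral.integral_of_le hlog]
    refine (tendsto_integral_of_dominated_convergence _ hpm hdom hbound' hlim').congr fun N => ?_
    have hterm : ∀ n ∈ Finset.Icc 1 N, Integrable (fun x =>
        (((ArithmeticFunction.moebius n : ℝ) / (n : ℝ) : ℝ) : 𝕜) *
          (f x * ((Real.exp (-(a / n * x)) : ℝ) : 𝕜)))
        (volume.restrict (Set.Ioc 0 (Real.log X))) := by
      intro n hn
      refine Integrable.const_mul (hfi.mul_bdd (c := 1) (Continuous.aestronglyMeasurable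
        (RCLike.continuous_ofReal.comp (by fun_prop)))
        ((ae_restrict_iff' measurableSet_Ioc).2 (Eventually.of_forall fun x hx => ?_))) _
      rw [Function.comp_apply, RCLike.norm_ofReal, Real.abs_exp]
      exact (monotoneBounded_exp ha.le hx.1.le).le n (Finset.mem_Icc.1 hn).1
    simp only [truncLaplace, intervalIntegral.integral_of_le hlog, ← integral_const_mul]
    rw [← integral_finsetSum _ hterm, ← integral_const_mul]
    congr 1
    funext x
    simp only [hp]
    push_cast
    simp only [Finset.mul_sum]
    exact Finset.sum_congr rfl fun n _ => by ring
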